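/- For an open set $D\subset\mathbb C^n$ write $\delta_D(z)=d(z,\partial D)$ for the Euclidean distance to the boundary. A domain is a non-empty connected open set; a domain $D\subset\mathbb C^n$ is pseudoconvex if $-\log\delta_D$ is plurisubharmonic (psh) on $D$ ($\mathbb C^n$ itself being pseudoconvex); a bounded domain $D$ is hyperconvex if there is a negative continuous psh function $\rho$ on $D$ such that $\{\rho<-c\}\subset\subset D$ for all $c>0$. For a closed ball $\overline B\subset\Omega$ of positive radius, the relative extremal function is $$\varrho(z)=\varrho_{\overline B}(z):=\sup\{u(z): u \text{ negative psh on }\Omega,\ u|_{\overline B}\le -1\},\qquad z\in\Omega .$$ **Proposition.** Let $n\ge 1$ and let $\Omega\subset\mathbb C^n$ be a bounded pseudoconvex domain. Suppose there exist numbers $\beta>0$, $\gamma>1$, $t_0>0$ and a family $\{\Omega^t\}_{0<t\le t_0}$ of pseudoconvex domains in $\mathbb C^n$ such that $\overline\Omega\subset\Omega^t$ for all $t$ and $$\beta t^\gamma\le\delta_{\Omega^t}(z)\le t\qquad\text{for all } z\in\partial\Omega,\ 0<t\le t_0 .$$ Then for every closed ball $\overline B\subset\Omega$ of positive radius and every real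 $\tau<\frac1{\gamma-1}$ there exist constants $C_\tau>0$ and $\eta>0$ such that $$-\varrho_{\overline B}(z)\le C_\tau\,(-\log\delta_\Omega(z))^{-\tau}\qquad\text{for all } z\in\Omega \text{ with } \delta_\Omega(z)<\eta .$$ In particular, $\Omega$ is hyperconvex. -/

import Mathlib

open Set MeasureTheory

noncomputable section

/-- `ℂⁿ` with the Euclidean norm. -/
abbrev Cn (n : ℕ) : Type := EuclideanSpace ℂ (Fin n)

/-- The mean `(1/2π) ∫₀^{2π} u(z + e^{iθ} w) dθ` of an extended-real function, as the Lebesgue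
integral of the positive part minus that of the negative part; for `u` bounded above on the circle
it takes values in `[-∞, ∞)`. -/
def circleMean {n : ℕ} (u : Cn n → EReal) (z w : Cn n) : EReal :=
  (((∫⁻ θ in Ioc (0 : ℝ) (2 * Real.pi),
      (u (z + Complex.exp (θ * Complex.I) • w)).toENNReal) / ENNReal.ofReal (2 * Real.pi) :
        ENNReal) : EReal)
  - (((∫⁻ θ in Ioc (0 : ℝ) (2 * Real.pi),
      (-(u (z + Complex.exp (θ * Complex.I) • w))).toENNReal) / ENNReal.ofReal (2 * Real.pi) :
        ENNReal) : EReal)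

/-- `u : Ω → [-∞, ∞)` is plurisubharmonic: upper semicontinuous, with the sub-mean value property
on every closed (affine) complex disc contained in `Ω`. -/
def IsPSHOn {n : ℕ} (u : Cn n → EReal) (Ω : Set (Cn n)) : Prop :=
  UpperSemicontinuousOn u Ω ∧ (∀ z ∈ Ω, u z < ⊤) ∧
    ∀ z w : Cn n, (∀ ζ : ℂ, ‖ζ‖ ≤ 1 → z + ζ • w ∈ Ω) → u z ≤ circleMean u z w

/-- The boundary distance `δ_Ω(z) = d(z, ∂Ω)`. -/
def bdryDist {n : ℕ} (Ω : Set (Cn n)) (z : Cn n) : ℝ := Metric.infDist z (frontier Ω)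

/-- A domain: a non-empty connected open set. -/
def IsDomainIn {n : ℕ} (Ω : Set (Cn n)) : Prop := IsOpen Ω ∧ IsConnected Ω

/-- A pseudoconvex domain: `-log δ_Ω` is plurisubharmonic on `Ω`. (For `Ω = ℂⁿ`, with empty
boundary, the function is the constant `0`, so that `ℂⁿ` is pseudoconvex.) -/
def IsPseudoconvexDomain {n : ℕ} (Ω : Set (Cn n)) : Prop :=
  IsDomainIn Ω ∧ IsPSHOn (fun z => ((-Real.log (bdryDist Ω z) : ℝ) : EReal)) Ω

/-- The relative extremal function of `K` in `Ω`: the pointwise supremum of all negative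
plurisubharmonic functions on `Ω` that are at most `-1` on `K`. -/
def relExtremal {n : ℕ} (Ω K : Set (Cn n)) (z : Cn n) : EReal :=
  sSup {x : EReal | ∃ u : Cn n → EReal, IsPSHOn u Ω ∧ (∀ y ∈ Ω, u y < 0) ∧
    (∀ y ∈ K, u y ≤ -1) ∧ x = u z}

/-- A hyperconvex domain: a bounded domain with a negative continuous plurisubharmonic function
`ρ` such that `{ρ < -c}` is relatively compact in `Ω` for all `c > 0`. -/
def IsHyperconvex {n : ℕ} (Ω : Set (Cn n)) : Prop :=
  IsDomainIn Ω ∧ Bornology.IsBounded Ω ∧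
    ∃ ρ : Cn n → ℝ, ContinuousOn ρ Ω ∧ IsPSHOn (fun z => (ρ z : EReal)) Ω ∧
      (∀ z ∈ Ω, ρ z < 0) ∧
      ∀ c : ℝ, 0 < c → IsCompact (closure {z ∈ Ω | ρ z < -c}) ∧ closure {z ∈ Ω | ρ z < -c} ⊆ Ω

end

/-! Put s = -log δ_Ω and, for t = e^{-L}, let ψ = -log δ_{Ω^t}, which is plurisubharmonic across ∂Ω.
The hypothesis on δ_{Ω^t} gives ψ ≤ s and ψ < γL + c on Ω, and ψ ≥ L - c where s ≥ L
(`neg_log_bdryDist_estimates`).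

Start from u = -1 and levels L_k = l^k L₀. If u ≥ -ε on {s ≥ L_k}, take ψ for the level L_{k+1} and
M = γL_{k+1} + c. The function ε(ψ - M)/(M - L_k) is negative, and is at most -ε ≤ u on {s = L_k},
so its maximum with u beyond that level glues to u (`IsContPSHOn.glue`). On {s ≥ L_{k+1}} the bound
improves from -ε to -qε as soon as q(M - L_k) ≥ (γ - 1)L_{k+1} + 2c. For large L_k this allows q =
l^{-τ} when (γ - 1)l < l^{-τ}(γl - 1), and such an l > 1 exists exactly because τ < 1/(γ - 1)
(`exists_ratio`). After k steps the bound is -(l^k)^{-τ}, comparable to -s^{-τ}. The sequence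
stabilizes on each sublevel set of s, so its limit is continuous and plurisubharmonic. It competes
in the relative extremal function and is an exhaustion.

Gluing needs plurisubharmonicity to be local, while the definition tests all discs in Ω;
`le_circleAverage_of_local` bridges this by a maximum principle. -/

/-! ### From small circles to the unit circle -/

open Real in
/-- The mean value property for the real part of an entire function. -/
theorem circleAverage_re_of_differentiable {F : ℂ → ℂ} (hF : Differentiable ℂ F) (c : ℂ) (R : ℝ) :
    circleAverage (fun z => (F z).re) c R = (F c).re := by
  have h := Complex.reCLM.circleAverage_comp_comm (f := F) (c := c) (R := R)
    (hF.continuous.continuousOn.circleIntegrable')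
  rw [hF.diffContOnCl.circleAverage] at h
  exact h

/-- A trigonometric polynomial is the sum of the boundary values of an entire function and of the
conjugate of an entire function. -/
theorem exists_entire_of_mem_span_fourier [Fact (0 < 2 * Real.pi)]
    {g : C(AddCircle (2 * Real.pi), ℂ)}
    (hg : g ∈ Submodule.span ℂ (range (fourier (T := 2 * Real.pi)))) :
    ∃ F G : ℂ → ℂ, Differentiable ℂ F ∧ Differentiable ℂ G ∧
      ∀ θ : ℝ, g (θ : AddCircle (2 * Real.pi)) =
        F (circleMap 0 1 θ) + (starRingEnd ℂ) (G (circleMap 0 1 θ)) := by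
  induction hg using Submodule.span_induction with
  | mem x hx =>
    obtain ⟨m, rfl⟩ := hx
    have key : ∀ (k : ℤ) (θ : ℝ), fourier k (θ : AddCircle (2 * Real.pi))
        = Complex.exp (k * (θ * Complex.I)) := by
      intro k θ
      rw [fourier_coe_apply]
      congr 1
      have : (Real.pi : ℂ) ≠ 0 := by exact_mod_cast Real.pi_ne_zero
      push_cast
      field_simp
    obtain ⟨k, rfl | rfl⟩ := m.eq_nat_or_neg
    · refine ⟨fun z => z ^ k, fun _ => 0, by fun_prop, by fun_prop, fun θ => ?_⟩
      rw [key]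
      simp [circleMap, ← Complex.exp_nat_mul]
    -- On the unit circle z^{-k} is the conjugate of z^k.
    · refine ⟨fun _ => 0, fun z => z ^ k, by fun_prop, by fun_prop, fun θ => ?_⟩
      rw [key]
      simp [circleMap, ← Complex.exp_nat_mul, ← Complex.exp_conj]
  | zero => exact ⟨fun _ => 0, fun _ => 0, by fun_prop, by fun_prop, by simp⟩
  | add x y _ _ hx hy =>
    obtain ⟨F, G, hF, hG, h⟩ := hx
    obtain ⟨F', G', hF', hG', h'⟩ := hy
    refine ⟨F + F', G + G', hF.add hF', hG.add hG', fun θ => ?_⟩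
    simp only [ContinuousMap.add_apply, h, h', Pi.add_apply, map_add]
    ring
  | smul c x _ hx =>
    obtain ⟨F, G, hF, hG, h⟩ := hx
    refine ⟨fun z => c * F z, fun z => (starRingEnd ℂ) c * G z, by fun_prop, by fun_prop,
      fun θ => ?_⟩
    simp only [ContinuousMap.smul_apply, h, map_mul, smul_eq_mul, Complex.conj_conj]
    ring

/-- A continuous real function on the unit circle is a uniform limit of real parts of entire
functions. -/
theorem exists_entire_re_approx {v : ℂ → ℝ} (hv : ContinuousOn v (Metric.sphere 0 1))
    {ε : ℝ} (hε : 0 < ε) :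
    ∃ F : ℂ → ℂ, Differentiable ℂ F ∧ ∀ z ∈ Metric.sphere (0 : ℂ) 1, |v z - (F z).re| < ε := by
  have : Fact (0 < 2 * Real.pi) := ⟨by positivity⟩
  have hmem : ∀ x : AddCircle (2 * Real.pi), (x.toCircle : ℂ) ∈ Metric.sphere (0 : ℂ) 1 :=
    fun x => by simpa using Circle.norm_coe x.toCircle
  let g : C(AddCircle (2 * Real.pi), ℂ) :=
    ⟨fun x => (v (x.toCircle : ℂ) : ℂ), by
      refine Complex.continuous_ofReal.comp (hv.comp_continuous ?_ hmem)
      exact continuous_subtype_val.comp AddCircle.continuous_toCircle⟩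
  have hg : g ∈ closure
      (Submodule.span ℂ (range (fourier (T := 2 * Real.pi))) : Set C(AddCircle (2 * Real.pi), ℂ)) := by
    rw [← Submodule.topologicalClosure_coe, span_fourier_closure_eq_top]
    trivial
  obtain ⟨p, hp, hgp⟩ := Metric.mem_closure_iff.1 hg ε hε
  obtain ⟨F, G, hF, hG, h⟩ := exists_entire_of_mem_span_fourier hp
  -- Conjugation does not change real parts, so Re(F + G) is the real part of the trigonometric
  -- polynomial.
  refine ⟨F + G, hF.add hG, fun z hz => ?_⟩
  obtain ⟨θ, rfl⟩ : ∃ θ : ℝ, circleMap 0 1 θ = z := by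
    have : z ∈ range (circleMap 0 1) := by rw [range_circleMap]; simpa using hz
    exact this
  have h1 := (ContinuousMap.dist_lt_iff hε).1 hgp (θ : AddCircle (2 * Real.pi))
  have h2 : g (θ : AddCircle (2 * Real.pi)) = (v (circleMap 0 1 θ) : ℂ) := by
    simp [g, AddCircle.toCircle_apply_mk, circleMap]
  rw [h2, h, Complex.dist_eq] at h1
  refine lt_of_le_of_lt ?_ h1
  refine le_trans (le_of_eq ?_) (Complex.abs_re_le_norm _)
  simp

open Real in
/-- A continuous function on the closed unit disc that has the sub-mean value property on small
circles has it on the unit circle. -/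
theorem le_circleAverage_of_local {v : ℂ → ℝ} (hv : ContinuousOn v (Metric.closedBall 0 1))
    (hloc : ∀ c ∈ Metric.ball (0 : ℂ) 1, ∃ r : ℝ, 0 < r ∧ ∀ R : ℝ, 0 < R → R < r →
      v c ≤ circleAverage v c R) :
    v 0 ≤ circleAverage v 0 1 := by
  have hsph : ContinuousOn v (Metric.sphere 0 1) := hv.mono Metric.sphere_subset_closedBall
  refine le_of_forall_pos_le_add fun ε hε => ?_
  obtain ⟨F, hF, happ⟩ := exists_entire_re_approx hsph (ε := ε / 3) (by positivity)
  have hFre : Continuous fun z => (F z).re := Complex.continuous_re.comp hF.continuous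
  -- The term in ‖z‖² makes the function strictly subharmonic, which excludes an interior maximum.
  obtain ⟨c, hc, hmax⟩ := (isCompact_closedBall (0 : ℂ) 1).exists_isMaxOn ⟨0, by simp⟩
    (f := fun z => v z - (F z).re + ε / 3 * ‖z‖ ^ 2)
    ((hv.sub hFre.continuousOn).add (by fun_prop))
  have hmean : (F 0).re ≤ circleAverage v 0 1 + ε / 3 := by
    have hi : CircleIntegrable v 0 1 := hsph.circleIntegrable zero_le_one
    rw [← circleAverage_re_of_differentiable hF 0 1, ← circleAverage_const (ε / 3) 0 1,
      ← circleAverage_fun_add hi (by fun_prop)]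
    refine circleAverage_mono hFre.continuousOn.circleIntegrable' (hi.add (by fun_prop)) ?_
    intro z hz
    have := abs_lt.1 (happ z (by simpa using hz))
    linarith
  suffices hbd : v c - (F c).re + ε / 3 * ‖c‖ ^ 2 ≤ 2 * ε / 3 by
    have h0 : v 0 - (F 0).re + ε / 3 * ‖(0 : ℂ)‖ ^ 2 ≤ v c - (F c).re + ε / 3 * ‖c‖ ^ 2 :=
      hmax (by simp : (0 : ℂ) ∈ Metric.closedBall 0 1)
    simp only [norm_zero] at h0
    linarith
  rcases eq_or_lt_of_le (mem_closedBall_zero_iff.1 hc) with h1 | h1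
  · have := abs_lt.1 (happ c (by simpa using h1))
    rw [h1]; linarith
  · exfalso
    obtain ⟨r, hr, hsub⟩ := hloc c (by simpa using h1)
    obtain ⟨R, hR0, hR⟩ := exists_between (lt_min hr (sub_pos.2 h1))
    have hRr := hR.trans_le (min_le_left _ _)
    have hR1 := hR.trans_le (min_le_right _ _)
    have hball : Metric.sphere c R ⊆ Metric.closedBall 0 1 := fun z hz => by
      have h2 : ‖z - c‖ = R := by simpa [dist_eq_norm] using hz
      have := norm_add_le (z - c) c
      rw [sub_add_cancel] at this
      rw [mem_closedBall_zero_iff]; linarith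
    -- On |z - c| = R one has |z|² = |c|² + R² + 2 Re(c̄(z - c)), so Re H = -Re F + (ε/3)|z|² there.
    -- At the centre Re H exceeds that expression by εR²/3, which contradicts maximality at c.
    let H : ℂ → ℂ := fun z => -F z +
      (ε / 3 : ℝ) * ((‖c‖ ^ 2 + R ^ 2 : ℝ) + 2 * (starRingEnd ℂ) c * (z - c))
    have hH : Differentiable ℂ H := by fun_prop
    have hHre : Continuous fun z => (H z).re := Complex.continuous_re.comp hH.continuous
    have hvi : CircleIntegrable v c R := (hv.mono hball).circleIntegrable hR0.le
    have hcircle : ∀ z ∈ Metric.sphere c |R|,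
        v z + (H z).re ≤ v c - (F c).re + ε / 3 * ‖c‖ ^ 2 := fun z hz => by
      rw [abs_of_pos hR0] at hz
      refine le_trans (le_of_eq ?_) (hmax (hball hz))
      have h2 : ‖z - c‖ ^ 2 = R ^ 2 := by
        have : ‖z - c‖ = R := by simpa [dist_eq_norm] using hz
        rw [this]
      simp only [H]
      rw [← h2, ← Complex.normSq_eq_norm_sq, ← Complex.normSq_eq_norm_sq,
        ← Complex.normSq_eq_norm_sq]
      simp [Complex.normSq_apply]
      ring
    have havg : circleAverage (fun z => v z + (H z).re) c R = circleAverage v c R + (H c).re := by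
      rw [circleAverage_fun_add hvi hHre.continuousOn.circleIntegrable',
        circleAverage_re_of_differentiable hH]
    have hle := circleAverage_mono_on_of_le_circle
      (hvi.add hHre.continuousOn.circleIntegrable') hcircle
    have hle' : circleAverage v c R + (H c).re ≤ v c - (F c).re + ε / 3 * ‖c‖ ^ 2 := havg ▸ hle
    have hHc : (H c).re = -(F c).re + ε / 3 * (‖c‖ ^ 2 + R ^ 2) := by
      simp only [H, sub_self, mul_zero, add_zero, ← Complex.ofReal_mul, Complex.add_re,
        Complex.neg_re, Complex.ofReal_re]
    have := hsub R hR0 hRr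
    have : 0 < ε / 3 * R ^ 2 := by positivity
    nlinarith

/-! ### Continuous plurisubharmonic functions: locality and gluing -/

/-- A continuous real function with the sub-mean value property on all complex discs in `Ω`. -/
def IsContPSHOn {n : ℕ} (f : Cn n → ℝ) (Ω : Set (Cn n)) : Prop :=
  ContinuousOn f Ω ∧ ∀ z w : Cn n, (∀ ζ : ℂ, ‖ζ‖ ≤ 1 → z + ζ • w ∈ Ω) →
    f z ≤ Real.circleAverage (fun ζ => f (z + ζ • w)) 0 1

section
variable {n : ℕ} {Ω : Set (Cn n)} {f g : Cn n → ℝ}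

theorem ContinuousOn.comp_complex_line {A : Set ℂ} (hf : ContinuousOn f Ω) {z w : Cn n}
    (h : ∀ ζ ∈ A, z + ζ • w ∈ Ω) :
    ContinuousOn (fun ζ : ℂ => f (z + ζ • w)) A :=
  hf.comp (by fun_prop) h

theorem ContinuousOn.circleIntegrable_complex_line (hf : ContinuousOn f Ω) {z w : Cn n}
    (h : ∀ ζ : ℂ, ‖ζ‖ ≤ 1 → z + ζ • w ∈ Ω) :
    CircleIntegrable (fun ζ : ℂ => f (z + ζ • w)) 0 1 :=
  (hf.comp_complex_line fun ζ hζ => h ζ (mem_sphere_zero_iff_norm.1 hζ).le).circleIntegrable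
    zero_le_one

/-- For real functions integrable over the circle, the extended mean is the usual one. -/
theorem circleMean_coe {z w : Cn n} (h : CircleIntegrable (fun ζ : ℂ => f (z + ζ • w)) 0 1) :
    circleMean (fun z => (f z : EReal)) z w =
      (Real.circleAverage (fun ζ => f (z + ζ • w)) 0 1 : ℝ) := by
  have hπ : (0 : ℝ) ≤ 2 * Real.pi := by positivity
  have hint : IntegrableOn (fun θ : ℝ => f (z + Complex.exp (θ * Complex.I) • w))
      (Ioc 0 (2 * Real.pi)) := by
    have := (intervalIntegrable_iff_integrableOn_Ioc_of_le hπ).1 h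
    simpa [circleMap] using this
  have key : ∀ {φ : ℝ → ℝ}, IntegrableOn φ (Ioc 0 (2 * Real.pi)) →
      (∫⁻ θ in Ioc 0 (2 * Real.pi), ENNReal.ofReal (φ θ)) / ENNReal.ofReal (2 * Real.pi) ≠ ⊤ := by
    intro φ hφ
    refine ENNReal.div_ne_top (ne_of_lt ?_) (by simpa using Real.pi_pos)
    exact hφ.lintegral_lt_top
  have hneg : IntegrableOn (fun θ : ℝ => -f (z + Complex.exp (θ * Complex.I) • w))
      (Ioc 0 (2 * Real.pi)) := hint.neg
  rw [circleMean]
  simp only [← EReal.coe_neg, EReal.real_coe_toENNReal]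
  rw [← EReal.coe_ennreal_toReal (key hint), ← EReal.coe_ennreal_toReal (key hneg),
    ← EReal.coe_sub, EReal.coe_eq_coe_iff, Real.circleAverage_def,
    intervalIntegral.integral_of_le hπ]
  simp only [circleMap, Complex.ofReal_one, one_mul, zero_add, ENNReal.toReal_div,
    ENNReal.toReal_ofReal hπ, smul_eq_mul]
  rw [integral_eq_lintegral_pos_part_sub_lintegral_neg_part hint]
  ring

theorem IsContPSHOn.isPSHOn (hf : IsContPSHOn f Ω) : IsPSHOn (fun z => (f z : EReal)) Ω := by
  refine ⟨?_, fun z _ => EReal.coe_lt_top _, fun z w h => ?_⟩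
  · exact (continuous_coe_real_ereal.comp_continuousOn hf.1).upperSemicontinuousOn
  · rw [circleMean_coe (hf.1.circleIntegrable_complex_line h)]
    exact EReal.coe_le_coe_iff.2 (hf.2 z w h)

theorem IsPSHOn.isContPSHOn (hc : ContinuousOn f Ω) (hf : IsPSHOn (fun z => (f z : EReal)) Ω) :
    IsContPSHOn f Ω := by
  refine ⟨hc, fun z w h => ?_⟩
  have := hf.2.2 z w h
  rwa [circleMean_coe (hc.circleIntegrable_complex_line h), EReal.coe_le_coe_iff] at this

theorem IsContPSHOn.mono {Ω' : Set (Cn n)} (hf : IsContPSHOn f Ω) (h : Ω' ⊆ Ω) :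
    IsContPSHOn f Ω' :=
  ⟨hf.1.mono h, fun z w hzw => hf.2 z w fun ζ hζ => h (hzw ζ hζ)⟩

theorem isContPSHOn_const (c : ℝ) : IsContPSHOn (fun _ : Cn n => c) Ω :=
  ⟨continuousOn_const, fun z w _ => by rw [Real.circleAverage_const]⟩

/-- Affine images with non-negative slope of a plurisubharmonic function. -/
theorem IsContPSHOn.const_mul_sub (hf : IsContPSHOn f Ω) {a : ℝ} (ha : 0 ≤ a) (b : ℝ) :
    IsContPSHOn (fun z => a * (f z - b)) Ω := by
  refine ⟨(hf.1.sub continuousOn_const).const_mul a |>.congr fun _ _ => rfl, fun z w h => ?_⟩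
  have h1 : Real.circleAverage (fun ζ : ℂ => a * (f (z + ζ • w) - b)) 0 1 =
      a * (Real.circleAverage (fun ζ : ℂ => f (z + ζ • w)) 0 1 - b) := by
    have h2 := Real.circleAverage_fun_smul (a := a) (c := 0) (R := 1)
      (f := fun ζ : ℂ => f (z + ζ • w) - b)
    have h3 := Real.circleAverage_fun_sub (hf.1.circleIntegrable_complex_line h)
      (circleIntegrable_const b 0 1)
    rw [Real.circleAverage_const] at h3
    simpa only [smul_eq_mul, h3] using h2
  rw [h1]
  exact mul_le_mul_of_nonneg_left (sub_le_sub_right (hf.2 z w h) b) ha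

theorem add_smul_mem_ball {z w : Cn n} {r : ℝ} (hw : ‖w‖ < r) {ζ : ℂ} (hζ : ‖ζ‖ ≤ 1) :
    z + ζ • w ∈ Metric.ball z r := by
  rw [mem_ball_iff_norm, add_sub_cancel_left, norm_smul]
  exact (mul_le_of_le_one_left (norm_nonneg w) hζ).trans_lt hw

/-- Plurisubharmonicity of continuous functions is a local property. -/
theorem isContPSHOn_of_local (hf : ContinuousOn f Ω)
    (hloc : ∀ z ∈ Ω, ∃ r : ℝ, 0 < r ∧ ∀ w : Cn n, ‖w‖ < r →
      f z ≤ Real.circleAverage (fun ζ => f (z + ζ • w)) 0 1) : IsContPSHOn f Ω := by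
  refine ⟨hf, fun z w h => ?_⟩
  have := le_circleAverage_of_local (v := fun ζ => f (z + ζ • w))
    (hf.comp_complex_line fun ζ hζ => h ζ (by simpa using hζ)) ?_
  · simpa using this
  intro c hc
  obtain ⟨r, hr, hsub⟩ := hloc (z + c • w) (h c (by simpa using (mem_ball_zero_iff.1 hc).le))
  -- The added 1 covers w = 0.
  refine ⟨r / (‖w‖ + 1), by positivity, fun R hR0 hR => ?_⟩
  have hR' : R * (‖w‖ + 1) < r := (lt_div_iff₀ (by positivity)).1 hR
  have hw : ‖(R : ℂ) • w‖ < r := by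
    rw [norm_smul, Complex.norm_real, Real.norm_of_nonneg hR0.le]
    linarith
  rw [Real.circleAverage_eq_circleAverage_zero_one]
  refine (hsub _ hw).trans_eq ?_
  congr 1
  ext ζ
  congr 1
  rw [smul_smul, add_assoc, ← add_smul]
  ring_nf

/-- Gluing: if `g ≤ f` on the level set `{s = L}`, then the function equal to `f` on `{s ≤ L}`
and to `max f g` elsewhere is plurisubharmonic. -/
theorem IsContPSHOn.glue (hΩ : IsOpen Ω) (hf : IsContPSHOn f Ω) (hg : IsContPSHOn g Ω)
    {s : Cn n → ℝ} (hs : ContinuousOn s Ω) {L : ℝ} (hL : ∀ z ∈ Ω, s z = L → g z ≤ f z) :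
    IsContPSHOn (fun z => if s z ≤ L then f z else max (f z) (g z)) Ω := by
  set u : Cn n → ℝ := fun z => if s z ≤ L then f z else max (f z) (g z) with hu
  have huc : ContinuousOn u Ω := by
    -- Frontier points of {s ≤ L} inside Ω satisfy s = L, where max f g = f.
    refine ContinuousOn.if (fun z hz => ?_) (hf.1.mono inter_subset_left)
      ((hf.1.sup hg.1).mono inter_subset_left)
    have hsz : ContinuousAt s z := hs.continuousAt (hΩ.mem_nhds hz.1)
    refine (max_eq_left (hL z hz.1 (le_antisymm ?_ ?_))).symm
    · by_contra! h
      exact mem_closure_iff_frequently.1 hz.2.1 ((hsz.eventually_const_lt h).mono fun _ => not_le.2)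
    · by_contra! h
      exact hz.2.2 (mem_interior_iff_mem_nhds.2 ((hsz.eventually_lt_const h).mono fun _ => le_of_lt))
  have hfu : ∀ z, f z ≤ u z := fun z => by
    simp only [hu]; split_ifs
    exacts [le_rfl, le_max_left _ _]
  refine isContPSHOn_of_local huc fun z hz => ?_
  obtain ⟨r, hr, hrΩ⟩ := Metric.isOpen_iff.1 hΩ z hz
  have havg : ∀ (h : Cn n → ℝ) (w : Cn n), IsContPSHOn h Ω → ‖w‖ < r →
      (∀ ζ : ℂ, ‖ζ‖ ≤ 1 → h (z + ζ • w) ≤ u (z + ζ • w)) →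
      h z ≤ Real.circleAverage (fun ζ => u (z + ζ • w)) 0 1 := fun h w hh hw hle => by
    have hd : ∀ ζ : ℂ, ‖ζ‖ ≤ 1 → z + ζ • w ∈ Ω := fun ζ hζ => hrΩ (add_smul_mem_ball hw hζ)
    refine (hh.2 z w hd).trans (Real.circleAverage_mono (hh.1.circleIntegrable_complex_line hd)
      (huc.circleIntegrable_complex_line hd) fun ζ hζ => hle ζ ?_)
    exact (by simpa using hζ : ‖ζ‖ = 1).le
  -- Since f ≤ u everywhere, the sub-mean property of f suffices where u = f, even on the level set.
  -- Where s > L, an open condition, g ≤ u nearby as well.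
  by_cases hzA : s z ≤ L
  · refine ⟨r, hr, fun w hw => ?_⟩
    have : u z = f z := if_pos hzA
    rw [this]
    exact havg f w hf hw fun ζ _ => hfu _
  · obtain ⟨ρ, hρ, hρA⟩ := Metric.eventually_nhds_iff_ball.1
      ((hs.continuousAt (hΩ.mem_nhds hz)).eventually_const_lt (not_le.1 hzA))
    refine ⟨min r ρ, lt_min hr hρ, fun w hw => ?_⟩
    have : u z = max (f z) (g z) := if_neg hzA
    rw [this]
    refine max_le (havg f w hf (hw.trans_le (min_le_left _ _)) fun ζ _ => hfu _)
      (havg g w hg (hw.trans_le (min_le_left _ _)) fun ζ hζ => ?_)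
    have hnA : ¬ s (z + ζ • w) ≤ L :=
      not_le.2 (hρA _ (add_smul_mem_ball (hw.trans_le (min_le_right _ _)) hζ))
    rw [hu]
    simp only [if_neg hnA]
    exact le_max_right _ _

/-- A function that coincides, on each sublevel set `{s ≤ L k}`, with a plurisubharmonic function
`U k` is plurisubharmonic, provided that `L` is unbounded. -/
theorem isContPSHOn_of_eqOn_sublevel (hΩ : IsOpen Ω) {s : Cn n → ℝ} (hs : ContinuousOn s Ω)
    {L : ℕ → ℝ} (hL : ∀ x : ℝ, ∃ k, x < L k) {U : ℕ → Cn n → ℝ} (hU : ∀ k, IsContPSHOn (U k) Ω)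
    (heq : ∀ k, ∀ z ∈ Ω, s z ≤ L k → f z = U k z) : IsContPSHOn f Ω := by
  have hnear : ∀ z ∈ Ω, ∃ k, ∃ r : ℝ, 0 < r ∧ Metric.ball z r ⊆ Ω ∧
      ∀ y ∈ Metric.ball z r, f y = U k y := fun z hz => by
    obtain ⟨k, hk⟩ := hL (s z)
    have h1 := (hs.continuousAt (hΩ.mem_nhds hz)).eventually_lt_const hk
    obtain ⟨r, hr, h⟩ := Metric.eventually_nhds_iff_ball.1 (h1.and (hΩ.mem_nhds hz))
    exact ⟨k, r, hr, fun y hy => (h y hy).2, fun y hy => heq k y (h y hy).2 (h y hy).1.le⟩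
  refine isContPSHOn_of_local (fun z hz => ?_) fun z hz => ?_
  · obtain ⟨k, r, hr, -, h⟩ := hnear z hz
    refine (((hU k).1.continuousAt (hΩ.mem_nhds hz)).congr ?_).continuousWithinAt
    exact Filter.eventually_of_mem (Metric.ball_mem_nhds z hr) fun y hy => (h y hy).symm
  · obtain ⟨k, r, hr, hrΩ, h⟩ := hnear z hz
    refine ⟨r, hr, fun w hw => ?_⟩
    rw [h z (Metric.mem_ball_self hr)]
    refine ((hU k).2 z w fun ζ hζ => hrΩ (add_smul_mem_ball hw hζ)).trans_eq ?_
    refine Real.circleAverage_congr_sphere fun ζ hζ => (h _ (add_smul_mem_ball hw ?_)).symm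
    exact (by simpa using hζ : ‖ζ‖ = 1).le

end

/-! ### Distance to the boundary -/

section
variable {n : ℕ} {Ω D : Set (Cn n)}

theorem continuous_bdryDist (Ω : Set (Cn n)) : Continuous (bdryDist Ω) :=
  Metric.continuous_infDist_pt _

theorem frontier_nonempty_of_isBounded (hn : 0 < n) (hne : Ω.Nonempty)
    (hb : Bornology.IsBounded Ω) : (frontier Ω).Nonempty := by
  have : Nonempty (Fin n) := ⟨⟨0, hn⟩⟩
  refine nonempty_frontier_iff.2 ⟨hne, fun h => ?_⟩
  exact NormedSpace.unbounded_univ ℂ (Cn n) (h ▸ hb)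

theorem bdryDist_pos (hΩ : IsOpen Ω) (hfr : (frontier Ω).Nonempty) {z : Cn n} (hz : z ∈ Ω) :
    0 < bdryDist Ω z := by
  refine (isClosed_frontier.notMem_iff_infDist_pos hfr).1 fun h => ?_
  rw [hΩ.frontier_eq] at h
  exact h.2 hz

theorem bdryDist_eq_zero {z : Cn n} (hz : z ∈ frontier Ω) : bdryDist Ω z = 0 :=
  Metric.infDist_zero_of_mem hz

/-- A segment from a point of the open set `Ω` to a point outside `Ω` meets the boundary of `Ω`. -/
theorem exists_frontier_mem_segment (hΩ : IsOpen Ω) {z y : Cn n} (hz : z ∈ Ω) (hy : y ∉ Ω) :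
    ∃ p ∈ frontier Ω, dist z p + dist p y = dist z y := by
  by_contra! hcon
  have hseg : ∀ p ∈ segment ℝ z y, p ∉ frontier Ω := fun p hp hpf =>
    hcon p hpf (dist_add_dist_of_mem_segment hp)
  have hdich : ∀ p ∈ segment ℝ z y, p ∉ Ω → p ∈ (closure Ω)ᶜ := fun p hp hpΩ hpc =>
    hseg p hp (by rw [hΩ.frontier_eq]; exact ⟨hpc, hpΩ⟩)
  obtain ⟨p, -, hp1, hp2⟩ := (convex_segment (𝕜 := ℝ) z y).isPreconnected Ω (closure Ω)ᶜ hΩ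
    isClosed_closure.isOpen_compl (fun p hp => or_iff_not_imp_left.2 (hdich p hp))
    ⟨z, left_mem_segment ℝ z y, hz⟩ ⟨y, right_mem_segment ℝ z y, hdich y (right_mem_segment ℝ z y) hy⟩
  exact hp2 (subset_closure hp1)

/-- If the closure of `Ω` lies in the open set `D`, then on `Ω` the distance to `∂D` is at least the
distance to `∂Ω`, and at least any lower bound for its values on `∂Ω`. -/
theorem max_le_bdryDist_of_closure_subset (hΩ : IsOpen Ω) (hD : IsOpen D)
    (hfr : (frontier D).Nonempty) (hsub : closure Ω ⊆ D) {b : ℝ}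
    (hb : ∀ p ∈ frontier Ω, b ≤ bdryDist D p) {z : Cn n} (hz : z ∈ Ω) :
    max (bdryDist Ω z) b ≤ bdryDist D z := by
  refine (Metric.le_infDist hfr).2 fun y hy => ?_
  have hyΩ : y ∉ Ω := fun h => by
    rw [hD.frontier_eq] at hy
    exact hy.2 (hsub (subset_closure h))
  obtain ⟨p, hp, hd⟩ := exists_frontier_mem_segment hΩ hz hyΩ
  rw [← hd]
  refine max_le ?_ ?_
  · exact (Metric.infDist_le_dist_of_mem hp).trans (le_add_of_nonneg_right dist_nonneg)
  · exact ((hb p hp).trans (Metric.infDist_le_dist_of_mem hy)).trans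
      (le_add_of_nonneg_left dist_nonneg)

/-- An upper bound for the distance to `∂D` on `∂Ω` propagates to nearby points. -/
theorem bdryDist_le_add (hfr : (frontier Ω).Nonempty) {t : ℝ}
    (ht : ∀ p ∈ frontier Ω, bdryDist D p ≤ t) (z : Cn n) :
    bdryDist D z ≤ t + bdryDist Ω z := by
  obtain ⟨p, hp, hd⟩ := isClosed_frontier.exists_infDist_eq_dist hfr z
  have h : bdryDist D z ≤ bdryDist D p + dist z p := Metric.infDist_le_infDist_add_dist
  have h' : bdryDist Ω z = dist z p := hd
  rw [h']
  exact h.trans (add_le_add_left (ht p hp) _)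

theorem isContPSHOn_neg_log_bdryDist (hD : IsPseudoconvexDomain D) (hfr : (frontier D).Nonempty) :
    IsContPSHOn (fun z => -Real.log (bdryDist D z)) D := by
  refine IsPSHOn.isContPSHOn ?_ hD.2
  exact ((continuous_bdryDist D).continuousOn.log fun z hz =>
    (bdryDist_pos hD.1.1 hfr hz).ne').neg

/-- Compactness of the superlevel sets of the boundary distance. -/
theorem isCompact_setOf_le_bdryDist (hΩ : IsOpen Ω) (hb : Bornology.IsBounded Ω) {d : ℝ}
    (hd : 0 < d) : IsCompact {z ∈ Ω | d ≤ bdryDist Ω z} := by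
  have heq : {z ∈ Ω | d ≤ bdryDist Ω z} = closure Ω ∩ {z | d ≤ bdryDist Ω z} := by
    ext z
    refine ⟨fun h => ⟨subset_closure h.1, h.2⟩, fun h => ⟨?_, h.2⟩⟩
    by_contra hz
    have h2 : d ≤ bdryDist Ω z := h.2
    rw [bdryDist_eq_zero (by rw [hΩ.frontier_eq]; exact ⟨h.1, hz⟩)] at h2
    exact h2.not_gt hd
  rw [heq]
  exact hb.isCompact_closure.inter_right
    (isClosed_le continuous_const (continuous_bdryDist Ω))

/-- A compact subset of `Ω` stays at a positive distance from the boundary. -/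
theorem exists_le_bdryDist_of_isCompact (hΩ : IsOpen Ω) (hfr : (frontier Ω).Nonempty)
    {K : Set (Cn n)} (hK : IsCompact K) (hKΩ : K ⊆ Ω) :
    ∃ d : ℝ, 0 < d ∧ ∀ z ∈ K, d ≤ bdryDist Ω z := by
  rcases K.eq_empty_or_nonempty with rfl | hne
  · exact ⟨1, one_pos, by simp⟩
  obtain ⟨x, hx, hmin⟩ := hK.exists_isMinOn hne (continuous_bdryDist Ω).continuousOn
  exact ⟨bdryDist Ω x, bdryDist_pos hΩ hfr (hKΩ hx), fun z hz => hmin hz⟩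

end

/-! ### The geometric iteration -/

/-- Existence of a ratio `l > 1` for which the geometric iteration gains the exponent `τ`. -/
theorem exists_ratio {γ τ : ℝ} (hγ : 1 < γ) (hτ : 0 < τ) (hτγ : τ < 1 / (γ - 1)) :
    ∃ l : ℝ, 1 < l ∧ (γ - 1) * l < l ^ (-τ) * (γ * l - 1) := by
  have h1 : τ * (γ - 1) < 1 := (lt_div_iff₀ (by linarith)).1 hτγ
  -- With l = 1 + x and l^{-τ} ≥ 1 - τx, the claim reduces to x(1 - τ(γ - 1) - τγx) > 0; this x
  -- makes τγx half of 1 - τ(γ - 1).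
  set x : ℝ := (1 - τ * (γ - 1)) / (2 * (τ * γ)) with hx
  have hτg : 0 < τ * γ := by positivity
  have hx0 : 0 < x := div_pos (by linarith) (by positivity)
  have hxe : τ * γ * x = (1 - τ * (γ - 1)) / 2 := by rw [hx]; field_simp
  refine ⟨1 + x, by linarith, ?_⟩
  have hpow : 1 - τ * x ≤ (1 + x) ^ (-τ) := by
    rw [Real.rpow_def_of_pos (by linarith)]
    have h2 := Real.add_one_le_exp (Real.log (1 + x) * -τ)
    have h3 : Real.log (1 + x) ≤ x := by
      have := Real.log_le_sub_one_of_pos (by linarith : 0 < 1 + x); linarith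
    have := mul_le_mul_of_nonneg_left h3 hτ.le
    linarith
  have hpos : 0 ≤ γ * (1 + x) - 1 := by nlinarith
  refine lt_of_lt_of_le ?_ (mul_le_mul_of_nonneg_right hpow hpos)
  have : 0 < x * (1 - τ * (γ - 1) - τ * γ * x) := mul_pos hx0 (by rw [hxe]; linarith)
  nlinarith

section
variable {n : ℕ} {Ω : Set (Cn n)} {s : Cn n → ℝ}

/-- One step of the iteration: a negative plurisubharmonic function bounded below by `-ε` on
`{L ≤ s}` is improved to one bounded below by `-q ε` on `{L' ≤ s}`, unchanged on `{s ≤ L}`. -/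
theorem IsContPSHOn.improve (hΩ : IsOpen Ω) (hs : ContinuousOn s Ω) {u ψ : Cn n → ℝ}
    (hu : IsContPSHOn u Ω) (hψ : IsContPSHOn ψ Ω) (hneg : ∀ z ∈ Ω, u z < 0)
    {L L' M m ε q : ℝ} (hε : 0 < ε) (hLM : L < M) (hLL' : L ≤ L') (hq : M - m ≤ q * (M - L))
    (hlow : ∀ z ∈ Ω, L ≤ s z → -ε ≤ u z)
    (hψs : ∀ z ∈ Ω, ψ z ≤ s z) (hψM : ∀ z ∈ Ω, ψ z < M) (hψm : ∀ z ∈ Ω, L' ≤ s z → m ≤ ψ z) :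
    ∃ u' : Cn n → ℝ, IsContPSHOn u' Ω ∧ (∀ z ∈ Ω, u' z < 0) ∧
      (∀ z ∈ Ω, L' ≤ s z → -(q * ε) ≤ u' z) ∧ (∀ z ∈ Ω, s z ≤ L → u' z = u z) ∧
      ∀ z ∈ Ω, u z ≤ u' z := by
  have hML : 0 < M - L := sub_pos.2 hLM
  have ha : 0 < ε / (M - L) := div_pos hε hML
  have haε : ε / (M - L) * (M - L) = ε := div_mul_cancel₀ _ hML.ne'
  have hbd : ∀ z ∈ Ω, s z = L → ε / (M - L) * (ψ z - M) ≤ u z := fun z hz hsz => by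
    refine le_trans ?_ (hlow z hz hsz.ge)
    have h1 := mul_le_mul_of_nonneg_left (sub_le_sub_right ((hψs z hz).trans_eq hsz) M) ha.le
    linarith
  -- The affine map applied to ψ sends L to -ε and M to 0.
  refine ⟨_, hu.glue hΩ (hψ.const_mul_sub ha.le M) hs hbd, fun z hz => ?_, fun z hz hsz => ?_,
    fun z _ hsz => if_pos hsz, fun z _ => ?_⟩
  · split_ifs
    · exact hneg z hz
    · exact max_lt (hneg z hz) (mul_neg_of_pos_of_neg ha (sub_neg.2 (hψM z hz)))
  · have h2 : -(q * ε) ≤ ε / (M - L) * (ψ z - M) := by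
      have h1 := mul_le_mul_of_nonneg_left
        ((sub_le_sub_left (hψm z hz hsz) M).trans hq) ha.le
      rw [mul_left_comm, haε] at h1
      linarith
    split_ifs with h
    · exact h2.trans (hbd z hz (le_antisymm h (hLL'.trans hsz)))
    · exact h2.trans (le_max_right _ _)
  · split_ifs
    exacts [le_rfl, le_max_left _ _]

/-- From a family of plurisubharmonic functions `ψ` with `ψ ≤ min s (γ L + c)`, and `L - c ≤ ψ` on
`{L ≤ s}`, one obtains a negative plurisubharmonic function, equal to `-1` on a given sublevel set
of `s`, whose modulus decays like `s ^ (-τ)`. -/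
theorem exists_isContPSHOn_decay (hΩ : IsOpen Ω) (hs : ContinuousOn s Ω) {γ τ c L₁ : ℝ}
    (hγ : 1 < γ) (hτ : 0 < τ) (hτγ : τ < 1 / (γ - 1)) (hc : 0 < c)
    (hψ : ∀ L : ℝ, L₁ ≤ L → ∃ ψ : Cn n → ℝ, IsContPSHOn ψ Ω ∧ (∀ z ∈ Ω, ψ z ≤ s z) ∧
      (∀ z ∈ Ω, ψ z < γ * L + c) ∧ ∀ z ∈ Ω, L ≤ s z → L - c ≤ ψ z) :
    ∃ u : Cn n → ℝ, IsContPSHOn u Ω ∧ (∀ z ∈ Ω, u z < 0) ∧ (∀ z ∈ Ω, s z ≤ L₁ → u z = -1) ∧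
      ∃ C : ℝ, 0 < C ∧ ∃ S : ℝ, 0 < S ∧ ∀ z ∈ Ω, S ≤ s z → -u z ≤ C * s z ^ (-τ) := by
  obtain ⟨l, hl, hlγ⟩ := exists_ratio hγ hτ hτγ
  have hl0 : 0 < l := one_pos.trans hl
  set κ : ℝ := l ^ (-τ) * (γ * l - 1) - (γ - 1) * l with hκ
  have hκ0 : 0 < κ := sub_pos.2 hlγ
  -- Large enough for `hψ` to apply, for positivity, and for κL₀ to absorb the additive error 2c.
  set L₀ : ℝ := max (max L₁ 1) (2 * c / κ) with hL₀
  have hL₀1 : 1 ≤ L₀ := (le_max_right _ _).trans (le_max_left _ _)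
  have hL₀L₁ : L₁ ≤ L₀ := (le_max_left _ _).trans (le_max_left _ _)
  have hL₀κ : 2 * c ≤ κ * L₀ := by
    have : 2 * c / κ ≤ L₀ := le_max_right _ _
    rw [div_le_iff₀ hκ0] at this
    linarith
  set q : ℝ := l ^ (-τ) with hq
  have hq0 : 0 < q := Real.rpow_pos_of_pos hl0 _
  let L : ℕ → ℝ := fun k => l ^ k * L₀
  have hL₀k : ∀ k, L₀ ≤ L k := fun k => le_mul_of_one_le_left (by linarith) (one_le_pow₀ hl.le)
  have hLs : ∀ k, L (k + 1) = l * L k := fun k => by simp only [L]; ring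
  have hLmono : Monotone L := monotone_nat_of_le_succ fun k => by
    rw [hLs]; exact le_mul_of_one_le_left (by linarith [hL₀k k]) hl.le
  have hLunb : ∀ x : ℝ, ∃ k, x < L k := fun x => by
    obtain ⟨k, hk⟩ := pow_unbounded_of_one_lt x hl
    exact ⟨k, hk.trans_le (le_mul_of_one_le_right (by positivity) hL₀1)⟩
  let P : ℕ → (Cn n → ℝ) → Prop := fun k u => IsContPSHOn u Ω ∧ (∀ z ∈ Ω, u z < 0) ∧
    ∀ z ∈ Ω, L k ≤ s z → -q ^ k ≤ u z
  have hstep : ∀ (k : ℕ) (u : Cn n → ℝ), P k u → ∃ u', P (k + 1) u' ∧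
      (∀ z ∈ Ω, s z ≤ L k → u' z = u z) ∧ ∀ z ∈ Ω, u z ≤ u' z := by
    rintro k u ⟨hu, hneg, hlow⟩
    obtain ⟨ψ, hψ1, hψ2, hψ3, hψ4⟩ := hψ (L (k + 1)) (hL₀L₁.trans (hL₀k _))
    have hLk : 0 < L k := by linarith [hL₀k k]
    have hκL : κ * L₀ ≤ κ * L k := mul_le_mul_of_nonneg_left (hL₀k k) hκ0.le
    have hγl : 0 < γ * l - 1 := by nlinarith
    obtain ⟨u', h1, h2, h3, h4, h5⟩ := hu.improve hΩ hs hψ1 hneg (L := L k) (L' := L (k + 1))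
      (M := γ * L (k + 1) + c) (m := L (k + 1) - c) (q := q) (pow_pos hq0 k)
      (by rw [hLs]; nlinarith) (hLmono k.le_succ)
      (by
        rw [hLs]
        have h6 : 2 * c ≤ (q * (γ * l - 1) - (γ - 1) * l) * L k := hL₀κ.trans hκL
        have h7 : 0 < q * c := mul_pos hq0 hc
        linarith) hlow hψ2 hψ3 hψ4
    exact ⟨u', ⟨h1, h2, by simpa only [pow_succ'] using h3⟩, h4, h5⟩
  have hbase : P 0 fun _ => -1 :=
    ⟨isContPSHOn_const _, fun _ _ => by norm_num, fun _ _ _ => by norm_num⟩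
  choose! F hFP hFeq hFle using hstep
  let U : ℕ → Cn n → ℝ := fun k => Nat.rec (fun _ => -1) F k
  have hUP : ∀ k, P k (U k) := fun k => by
    induction k with
    | zero => exact hbase
    | succ k ih => exact hFP k _ ih
  have hUle : ∀ z ∈ Ω, Monotone fun k => U k z := fun z hz =>
    monotone_nat_of_le_succ fun k => hFle k _ (hUP k) z hz
  have hUeq : ∀ k j, k ≤ j → ∀ z ∈ Ω, s z ≤ L k → U j z = U k z := fun k j hkj z hz hsz => by
    induction j, hkj using Nat.le_induction with
    | base => rfl
    | succ j hkj ih => exact (hFeq j _ (hUP j) z hz (hsz.trans (hLmono hkj))).trans ih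
  -- `U k z` is constant in k from `N z` on, so `U (N z) z` is the limit.
  choose N hN using fun z => hLunb (s z)
  have hveq : ∀ k, ∀ z ∈ Ω, s z ≤ L k → U (N z) z = U k z := fun k z hz hsz => by
    rcases le_total k (N z) with h | h
    · exact hUeq k _ h z hz hsz
    · exact (hUeq _ k h z hz (hN z).le).symm
  have hqpow : ∀ k : ℕ, q ^ k = (l ^ k) ^ (-τ) := fun k => by
    rw [hq, ← Real.rpow_natCast, ← Real.rpow_natCast, ← Real.rpow_mul hl0.le,
      ← Real.rpow_mul hl0.le, mul_comm]
  refine ⟨fun z => U (N z) z, isContPSHOn_of_eqOn_sublevel hΩ hs hLunb (fun k => (hUP k).1) hveq,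
    fun z hz => (hUP _).2.1 z hz, fun z hz hsz => ?_, (l * L₀) ^ τ, by positivity, L₀, by positivity,
    fun z hz hsz => ?_⟩
  · exact hveq 0 z hz (by simpa [L] using hsz.trans hL₀L₁)
  · have hs0 : 0 < s z := by linarith
    -- Here L_k ≤ s(z) < L_{k+1}: the limit equals U_{k+1} ≥ U_k ≥ -q^k at z.
    obtain ⟨k, hk1, hk2⟩ := exists_nat_pow_near ((one_le_div (by positivity)).2 hsz) hl
    rw [le_div_iff₀ (by positivity)] at hk1
    rw [div_lt_iff₀ (by positivity)] at hk2
    have hlow : -q ^ k ≤ U (N z) z := by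
      rw [hveq (k + 1) z hz hk2.le]
      exact ((hUP k).2.2 z hz hk1).trans (hUle z hz k.le_succ)
    have hdiv : s z / (l * L₀) ≤ l ^ k := by
      rw [div_le_iff₀ (by positivity)]
      refine hk2.le.trans_eq ?_
      ring
    have hpow : q ^ k ≤ (l * L₀) ^ τ * s z ^ (-τ) := by
      rw [hqpow]
      refine (Real.rpow_le_rpow_of_nonpos (by positivity) hdiv (by linarith)).trans_eq ?_
      rw [Real.div_rpow hs0.le (by positivity), Real.rpow_neg (by positivity : 0 ≤ l * L₀),
        div_inv_eq_mul, mul_comm]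
    linarith

end

/-! ### Approximating domains, the extremal function and hyperconvexity -/

section
variable {n : ℕ} {Ω D : Set (Cn n)}

/-- Estimates for `-log δ_D` on `Ω`, where `D` is a pseudoconvex neighbourhood of the closure of `Ω`
with `β t ^ γ ≤ δ_D ≤ t` on `∂Ω`, in terms of `L = -log t`. -/
theorem neg_log_bdryDist_estimates (hΩ : IsOpen Ω) (hfr : (frontier Ω).Nonempty)
    {β γ L : ℝ} (hβ : 0 < β) (hD : IsPseudoconvexDomain D) (hsub : closure Ω ⊆ D)
    (hdist : ∀ z ∈ frontier Ω, β * Real.exp (-L) ^ γ ≤ bdryDist D z ∧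
      bdryDist D z ≤ Real.exp (-L)) :
    IsContPSHOn (fun z => -Real.log (bdryDist D z)) Ω ∧
      (∀ z ∈ Ω, -Real.log (bdryDist D z) ≤ -Real.log (bdryDist Ω z)) ∧
      (∀ z ∈ Ω, -Real.log (bdryDist D z) < γ * L + (|Real.log β| + 1)) ∧
      ∀ z ∈ Ω, L ≤ -Real.log (bdryDist Ω z) →
        L - (|Real.log β| + 1) ≤ -Real.log (bdryDist D z) := by
  have hb : 0 < β * Real.exp (-L) ^ γ := by positivity
  -- The distance to an empty frontier is 0 by convention, against the positive lower bound.
  have hDfr : (frontier D).Nonempty := by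
    obtain ⟨p, hp⟩ := hfr
    by_contra hne
    have h0 : bdryDist D p = 0 := by
      rw [bdryDist, not_nonempty_iff_eq_empty.1 hne, Metric.infDist_empty]
    exact (hb.trans_le (hdist p hp).1).ne' h0
  have hmax : ∀ z ∈ Ω, max (bdryDist Ω z) (β * Real.exp (-L) ^ γ) ≤ bdryDist D z := fun z hz =>
    max_le_bdryDist_of_closure_subset hΩ hD.1.1 hDfr hsub (fun p hp => (hdist p hp).1) hz
  refine ⟨(isContPSHOn_neg_log_bdryDist hD hDfr).mono (subset_closure.trans hsub), fun z hz => ?_,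
    fun z hz => ?_, fun z hz hL => ?_⟩
  · exact neg_le_neg (Real.log_le_log (bdryDist_pos hΩ hfr hz)
      ((le_max_left _ _).trans (hmax z hz)))
  · have h1 := Real.log_le_log hb ((le_max_right _ _).trans (hmax z hz))
    rw [Real.log_mul hβ.ne' (by positivity), Real.log_rpow (Real.exp_pos _), Real.log_exp] at h1
    linarith [neg_abs_le (Real.log β)]
  · have hδ : bdryDist Ω z ≤ Real.exp (-L) :=
      (Real.log_le_iff_le_exp (bdryDist_pos hΩ hfr hz)).1 (by linarith)
    -- The factor 2 costs log 2 < 1, covered by the 1 in the additive constant.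
    have h1 : bdryDist D z ≤ 2 * Real.exp (-L) := by
      linarith [bdryDist_le_add hfr (fun p hp => (hdist p hp).2) z]
    have h2 := Real.log_le_log (bdryDist_pos hD.1.1 hDfr (hsub (subset_closure hz))) h1
    rw [Real.log_mul two_ne_zero (Real.exp_pos _).ne', Real.log_exp] at h2
    linarith [abs_nonneg (Real.log β), Real.log_two_lt_d9]

/-- A continuous negative plurisubharmonic function with logarithmic decay at the boundary, equal
to `-1` on a given compact set. -/
theorem exists_isContPSHOn_log_decay (hfr : (frontier Ω).Nonempty) (hΩ : IsOpen Ω)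
    {β γ t₀ τ : ℝ} (hβ : 0 < β) (hγ : 1 < γ) (ht₀ : 0 < t₀) {Ωt : ℝ → Set (Cn n)}
    (hpsc : ∀ t : ℝ, 0 < t → t ≤ t₀ → IsPseudoconvexDomain (Ωt t))
    (hsub : ∀ t : ℝ, 0 < t → t ≤ t₀ → closure Ω ⊆ Ωt t)
    (hdist : ∀ t : ℝ, 0 < t → t ≤ t₀ → ∀ z ∈ frontier Ω,
      β * t ^ γ ≤ bdryDist (Ωt t) z ∧ bdryDist (Ωt t) z ≤ t)
    (hτ : 0 < τ) (hτγ : τ < 1 / (γ - 1)) {K : Set (Cn n)} (hK : IsCompact K) (hKΩ : K ⊆ Ω) :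
    ∃ u : Cn n → ℝ, IsContPSHOn u Ω ∧ (∀ z ∈ Ω, u z < 0) ∧ (∀ z ∈ K, u z = -1) ∧
      ∃ C : ℝ, 0 < C ∧ ∃ S : ℝ, 0 < S ∧ ∀ z ∈ Ω, S ≤ -Real.log (bdryDist Ω z) →
        -u z ≤ C * (-Real.log (bdryDist Ω z)) ^ (-τ) := by
  have hs : ContinuousOn (fun z => -Real.log (bdryDist Ω z)) Ω :=
    ((continuous_bdryDist Ω).continuousOn.log fun z hz => (bdryDist_pos hΩ hfr hz).ne').neg
  obtain ⟨d, hd, hdK⟩ := exists_le_bdryDist_of_isCompact hΩ hfr hK hKΩ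
  obtain ⟨u, hu, hneg, hone, hdecay⟩ := exists_isContPSHOn_decay hΩ hs hγ hτ hτγ
    -- The first entry of the maximum ensures e^{-L} ≤ t₀; the second puts K in the sublevel set
    -- where u = -1.
    (c := |Real.log β| + 1) (L₁ := max (-Real.log t₀) (-Real.log d)) (by positivity) fun L hL => by
      have ht : Real.exp (-L) ≤ t₀ := by
        rw [← Real.le_log_iff_exp_le ht₀]
        linarith [le_max_left (-Real.log t₀) (-Real.log d)]
      exact ⟨_, neg_log_bdryDist_estimates hΩ hfr hβ (hpsc _ (Real.exp_pos _) ht)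
        (hsub _ (Real.exp_pos _) ht) (hdist _ (Real.exp_pos _) ht)⟩
  refine ⟨u, hu, hneg, fun z hz => hone z (hKΩ hz) ?_, hdecay⟩
  exact (neg_le_neg (Real.log_le_log hd (hdK z hz))).trans (le_max_right _ _)

theorem IsContPSHOn.neg_relExtremal_le {u : Cn n → ℝ} {K : Set (Cn n)} (hu : IsContPSHOn u Ω)
    (hneg : ∀ z ∈ Ω, u z < 0) (hK : ∀ z ∈ K, u z ≤ -1) (z : Cn n) :
    -relExtremal Ω K z ≤ ((-u z : ℝ) : EReal) := by
  rw [EReal.coe_neg, EReal.neg_le_neg_iff]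
  refine le_sSup ⟨fun y => (u y : EReal), hu.isPSHOn, fun y hy => ?_, fun y hy => ?_, rfl⟩
  · exact EReal.coe_lt_coe_iff.2 (hneg y hy)
  · exact EReal.coe_le_coe_iff.2 (hK y hy)

/-- A continuous negative plurisubharmonic function with logarithmic decay at the boundary makes a
bounded domain hyperconvex. -/
theorem IsContPSHOn.isHyperconvex (hΩ : IsDomainIn Ω) (hb : Bornology.IsBounded Ω)
    (hfr : (frontier Ω).Nonempty)
    {u : Cn n → ℝ} (hu : IsContPSHOn u Ω) (hneg : ∀ z ∈ Ω, u z < 0) {C S τ : ℝ} (hτ : 0 < τ)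
    (hdecay : ∀ z ∈ Ω, S ≤ -Real.log (bdryDist Ω z) →
      -u z ≤ C * (-Real.log (bdryDist Ω z)) ^ (-τ)) : IsHyperconvex Ω := by
  refine ⟨hΩ, hb, u, hu.1, hu.isPSHOn, hneg, fun c hc => ?_⟩
  have hlim : Filter.Tendsto (fun x : ℝ => C * x ^ (-τ)) Filter.atTop (nhds 0) := by
    simpa using (tendsto_rpow_neg_atTop hτ).const_mul C
  obtain ⟨T, hT⟩ := Filter.eventually_atTop.1 (hlim.eventually_lt_const hc)
  set R : ℝ := max S T
  have hsubset : {z ∈ Ω | u z < -c} ⊆ {z ∈ Ω | Real.exp (-R) ≤ bdryDist Ω z} := by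
    rintro z ⟨hz, huz⟩
    refine ⟨hz, ?_⟩
    by_contra! hlt
    have hpos : 0 < bdryDist Ω z := bdryDist_pos hΩ.1 hfr hz
    have hR : R < -Real.log (bdryDist Ω z) := by
      linarith [(Real.log_lt_iff_lt_exp hpos).2 hlt]
    have h1 := hdecay z hz ((le_max_left _ _).trans hR.le)
    have h2 := hT _ ((le_max_right S T).trans hR.le)
    linarith
  have hcpt := isCompact_setOf_le_bdryDist hΩ.1 hb (Real.exp_pos (-R))
  have hcl := closure_minimal hsubset hcpt.isClosed
  exact ⟨hcpt.of_isClosed_subset isClosed_closure hcl, hcl.trans (sep_subset _ _)⟩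

end

theorem proposition3p1 {n : ℕ} (hn : 0 < n) (Ω : Set (Cn n))
    (hΩ : IsPseudoconvexDomain Ω) (hbdd : Bornology.IsBounded Ω)
    (β γ t₀ : ℝ) (hβ : 0 < β) (hγ : 1 < γ) (ht₀ : 0 < t₀)
    (Ωt : ℝ → Set (Cn n))
    (hpsc : ∀ t : ℝ, 0 < t → t ≤ t₀ → IsPseudoconvexDomain (Ωt t))
    (hsub : ∀ t : ℝ, 0 < t → t ≤ t₀ → closure Ω ⊆ Ωt t)
    (hdist : ∀ t : ℝ, 0 < t → t ≤ t₀ → ∀ z ∈ frontier Ω,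
      β * t ^ γ ≤ bdryDist (Ωt t) z ∧ bdryDist (Ωt t) z ≤ t) :
    (∀ (a : Cn n) (r : ℝ), 0 < r → Metric.closedBall a r ⊆ Ω →
      ∀ τ : ℝ, τ < 1 / (γ - 1) → ∃ C : ℝ, 0 < C ∧ ∃ η : ℝ, 0 < η ∧
        ∀ z ∈ Ω, bdryDist Ω z < η →
          -relExtremal Ω (Metric.closedBall a r) z ≤
            ((C * (-Real.log (bdryDist Ω z)) ^ (-τ) : ℝ) : EReal)) ∧
    IsHyperconvex Ω := by
  have hfr := frontier_nonempty_of_isBounded hn hΩ.1.2.nonempty hbdd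
  have hγ' : 0 < 1 / (γ - 1) := one_div_pos.2 (by linarith)
  refine ⟨fun a r _ hball τ hτ => ?_, ?_⟩
  -- The iteration needs a positive exponent, whereas τ may be negative or zero. The larger τ'
  -- serves for τ because η is chosen so that -log δ_Ω > 1.
  · obtain ⟨τ', hτ', hτ'γ⟩ := exists_between (max_lt hγ' hτ)
    obtain ⟨u, hu, hneg, hone, C, hC, S, -, hdecay⟩ := exists_isContPSHOn_log_decay hfr hΩ.1.1 hβ hγ
      ht₀ hpsc hsub hdist ((le_max_left _ _).trans_lt hτ') hτ'γ (isCompact_closedBall a r) hball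
    refine ⟨C, hC, Real.exp (-max S 1), Real.exp_pos _, fun z hz hzη => ?_⟩
    refine (hu.neg_relExtremal_le hneg (fun y hy => (hone y hy).le) z).trans ?_
    have hlog : max S 1 < -Real.log (bdryDist Ω z) := by
      linarith [(Real.log_lt_iff_lt_exp (bdryDist_pos hΩ.1.1 hfr hz)).2 hzη]
    rw [EReal.coe_le_coe_iff]
    refine (hdecay z hz ((le_max_left _ _).trans hlog.le)).trans
      (mul_le_mul_of_nonneg_left ?_ hC.le)
    exact Real.rpow_le_rpow_of_exponent_le ((le_max_right _ _).trans hlog.le)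
      (neg_le_neg ((le_max_right _ _).trans hτ'.le))
  · obtain ⟨τ, hτ, hτγ⟩ := exists_between hγ'
    -- Hyperconvexity needs no normalization on a ball, so K is empty.
    obtain ⟨u, hu, hneg, -, C, -, S, -, hdecay⟩ := exists_isContPSHOn_log_decay hfr hΩ.1.1 hβ hγ
      ht₀ hpsc hsub hdist hτ hτγ isCompact_empty (empty_subset Ω)
    exact hu.isHyperconvex hΩ.1 hbdd hfr hneg hτ hdecay
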